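/- Let $G$ be a finite group and let $s : G \to \{1,-1\}$ be a homomorphism, where $g$ is called unitary if $s(g)=1$ and anti-unitary if $s(g)=-1$. (If $s$ is non-trivial, then $G = H \cup T_0H$ is an anti-unitary group with maximal unitary subgroup $H=\ker s$; the purely unitary case $s\equiv 1$ is included.) Let $\kappa_{1}=I$ and let $\kappa_{-1}$ be entrywise complex conjugation on $V=\mathbb{C}^d$. Let $\omega : G\times G\to U(1)$ be a factor system, that is, $\omega(g_1,g_2)\,\omega(g_1g_2,g_3)=\omega(g_2,g_3)^{s(g_1)}\,\omega(g_1,g_2g_3)$, and let $M$ be a $d$-dimensional unitary projective co-representation of $G$ with factor system $\omega$: the $M(g)$ are unitary $d\times d$ matrices with $$M(g_1)\kappa_{s(g_1)}\,M(g_2)\kappa_{s(g_2)}=\omega(g_1,g_2)\,M(g_1g_2)\kappa_{s(g_1g_2)}\qquad (g_1,g_2\in G).$$ Let $Q_0$ be a random complex $d\times d$ matrix whose law is absolutely continuous with respect to Lebesgue measure on $\mathbb{C}^{d\times d}$, and put $$q_r=\sum_{g\in G}[M(g)\kappa_{s(g)}]\,Q_0\,[M(g)\kappa_{s(g)}]^{-1},\qquad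 Q_r=q_r+q_r^\dagger .$$ Then, almost surely, the eigenspaces of $Q_r$ reduce $V$ into irreducible components: $V$ is the direct sum of the eigenspaces of $Q_r$; every eigenspace is a nonzero complex subspace that is invariant under all $M(g)\kappa_{s(g)}$ and has no invariant complex subspaces other than $0$ and itself; and the orthogonal projectors onto the eigenspaces are mutually orthogonal, sum to the identity, and commute with all $M(g)\kappa_{s(g)}$. -/

import Mathlib

open MeasureTheory ComplexConjugate

noncomputable section

namespace ProjCorep

/-- The carrier space `V = ℂ^d` with its standard Hermitian inner product. -/
abbrev Carrier (d : ℕ) : Type := EuclideanSpace ℂ (Fin d)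

/-- The operator `κ_ε` on `ℂ^d`: the identity for `ε = 1`, and entrywise complex conjugation for
`ε = -1`. It is real-linear. -/
def kappa (d : ℕ) (ε : ℤˣ) : Carrier d →ₗ[ℝ] Carrier d where
  toFun v := WithLp.toLp 2 fun i => if ε = 1 then v i else conj (v i)
  map_add' v w := by
    ext i; by_cases h : ε = 1 <;> simp [h]
  map_smul' c v := by
    ext i; by_cases h : ε = 1 <;> simp [h]

/-- The linear operator of a complex matrix, regarded as a real-linear operator. -/
def matOp {d : ℕ} (A : Matrix (Fin d) (Fin d) ℂ) : Module.End ℝ (Carrier d) :=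
  (Matrix.toEuclideanLin A).restrictScalars ℝ

variable {G : Type*} [Group G]

/-- A `U(1)`-valued factor system on a group `G` whose unitary elements are those with `s g = 1`
and whose anti-unitary elements are those with `s g = -1`. (For `z` in `U(1)`, `z ^ (-1)` is the
complex conjugate of `z`.) -/
structure FactorSystem (s : G →* ℤˣ) where
  toFun : G → G → Circle
  cocycle : ∀ g₁ g₂ g₃ : G,
    toFun g₁ g₂ * toFun (g₁ * g₂) g₃
      = toFun g₂ g₃ ^ ((s g₁ : ℤˣ) : ℤ) * toFun g₁ (g₂ * g₃)

/-- A `d`-dimensional unitary projective co-representation with factor system `ω`: unitary matrices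
`M g` with `M(g₁)κ_{s(g₁)} M(g₂)κ_{s(g₂)} = ω(g₁,g₂) M(g₁g₂)κ_{s(g₁g₂)}`. -/
structure Corep (s : G →* ℤˣ) (ω : FactorSystem s) (d : ℕ) where
  M : G → Matrix (Fin d) (Fin d) ℂ
  unitary : ∀ g, M g ∈ Matrix.unitaryGroup (Fin d) ℂ
  mul : ∀ (g₁ g₂ : G) (v : Carrier d),
    (matOp (M g₁) * kappa d (s g₁)) ((matOp (M g₂) * kappa d (s g₂)) v)
      = (ω.toFun g₁ g₂ : ℂ) • (matOp (M (g₁ * g₂)) * kappa d (s (g₁ * g₂))) v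

/-- Conjugation of a matrix by `κ_ε`: the matrix of `κ_ε A κ_ε⁻¹`. -/
def kappaConj {d : ℕ} (ε : ℤˣ) (A : Matrix (Fin d) (Fin d) ℂ) : Matrix (Fin d) (Fin d) ℂ :=
  if ε = 1 then A else A.map conj

namespace Corep

variable {s : G →* ℤˣ} {ω : FactorSystem s} {d : ℕ} (ρ : Corep s ω d)

/-- The operator `M(g)κ_{s(g)}` on `V`. -/
def op (g : G) : Module.End ℝ (Carrier d) := matOp (ρ.M g) * kappa d (s g)

/-- The matrix `q_r = ∑_g [M(g)κ_{s(g)}] Q₀ [M(g)κ_{s(g)}]⁻¹`; see `matOp_avg` for the equality of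
operators. -/
def avg [Fintype G] (Q₀ : Matrix (Fin d) (Fin d) ℂ) : Matrix (Fin d) (Fin d) ℂ :=
  ∑ g, ρ.M g * kappaConj (s g) Q₀ * (ρ.M g)⁻¹

/-- The Hermitian matrix `Q_r = q_r + q_r†`. -/
def hermAvg [Fintype G] (Q₀ : Matrix (Fin d) (Fin d) ℂ) : Matrix (Fin d) (Fin d) ℂ :=
  ρ.avg Q₀ + (ρ.avg Q₀).conjTranspose

/-- The complex-linear operator on `V` given by the matrix `Q_r`. -/
def hermOp [Fintype G] (Q₀ : Matrix (Fin d) (Fin d) ℂ) : Module.End ℂ (Carrier d) :=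
  Matrix.toEuclideanLin (ρ.hermAvg Q₀)

/-- The orthogonal projector of `V` onto the eigenspace of `Q_r` with eigenvalue `μ`. -/
def eigenProj [Fintype G] (Q₀ : Matrix (Fin d) (Fin d) ℂ) (μ : (ρ.hermOp Q₀).Eigenvalues) :
    Carrier d →L[ℂ] Carrier d :=
  ((ρ.hermOp Q₀).eigenspace μ).starProjection

/-- A complex subspace of `V` is invariant if every `M(g)κ_{s(g)}` maps it into itself. -/
def Invariant (W : Submodule ℂ (Carrier d)) : Prop :=
  ∀ g : G, ∀ v ∈ W, ρ.op g v ∈ W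

/-- An irreducible component: a nonzero invariant complex subspace whose only invariant complex
subspaces are `0` and itself. -/
structure IsIrreducibleComponent (W : Submodule ℂ (Carrier d)) : Prop where
  ne_bot : W ≠ ⊥
  invariant : ρ.Invariant W
  eq_bot_or_eq : ∀ W' : Submodule ℂ (Carrier d), W' ≤ W → ρ.Invariant W' → W' = ⊥ ∨ W' = W

/-- The eigenspaces of `Q_r` provide projectors reducing `V` into irreducible components: every
eigenspace is an irreducible component, `V` is the direct sum of the eigenspaces, and the orthogonal
projectors onto them are mutually orthogonal, sum to the identity and commute with every
`M(g)κ_{s(g)}`. -/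
structure EigenspacesReduce [Fintype G] (Q₀ : Matrix (Fin d) (Fin d) ℂ) : Prop where
  irreducible : ∀ μ : (ρ.hermOp Q₀).Eigenvalues,
    ρ.IsIrreducibleComponent ((ρ.hermOp Q₀).eigenspace μ)
  isInternal : DirectSum.IsInternal
    (fun μ : (ρ.hermOp Q₀).Eigenvalues => (ρ.hermOp Q₀).eigenspace μ)
  orthogonal : ∀ μ ν : (ρ.hermOp Q₀).Eigenvalues, μ ≠ ν →
    ρ.eigenProj Q₀ μ ∘L ρ.eigenProj Q₀ ν = 0
  sum_eq_id : ∑ μ : (ρ.hermOp Q₀).Eigenvalues, ρ.eigenProj Q₀ μ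
    = ContinuousLinearMap.id ℂ (Carrier d)
  commute : ∀ (μ : (ρ.hermOp Q₀).Eigenvalues) (g : G) (v : Carrier d),
    ρ.eigenProj Q₀ μ (ρ.op g v) = ρ.op g (ρ.eigenProj Q₀ μ v)

end Corep

theorem matOp_mul {d : ℕ} (A B : Matrix (Fin d) (Fin d) ℂ) :
    matOp (A * B) = matOp A * matOp B := by
  ext v i
  simp [matOp, Matrix.toLpLin_apply, Matrix.mulVec_mulVec]

theorem matOp_one {d : ℕ} : matOp (1 : Matrix (Fin d) (Fin d) ℂ) = 1 := by
  ext v i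
  simp [matOp]

theorem kappa_mul_self (d : ℕ) (ε : ℤˣ) : (kappa d ε * kappa d ε : Module.End ℝ _) = 1 := by
  ext v i
  by_cases h : ε = 1 <;> simp [kappa, h]

theorem kappa_mul_matOp {d : ℕ} (ε : ℤˣ) (A : Matrix (Fin d) (Fin d) ℂ) :
    kappa d ε * matOp A = matOp (kappaConj ε A) * kappa d ε := by
  ext v i
  by_cases h : ε = 1 <;>
    simp [kappa, matOp, kappaConj, h, Matrix.toLpLin_apply, Matrix.mulVec, dotProduct]

theorem Corep.mul_inv {s : G →* ℤˣ} {ω : FactorSystem s} {d : ℕ} (ρ : Corep s ω d) (g : G) :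
    ρ.M g * (ρ.M g)⁻¹ = 1 := by
  have h := Matrix.mem_unitaryGroup_iff.1 (ρ.unitary g)
  rw [Matrix.inv_eq_right_inv h, h]

theorem Corep.inv_mul {s : G →* ℤˣ} {ω : FactorSystem s} {d : ℕ} (ρ : Corep s ω d) (g : G) :
    (ρ.M g)⁻¹ * ρ.M g = 1 :=
  mul_eq_one_comm.1 (ρ.mul_inv g)

/-- `M(g)κ_{s(g)}` as an invertible operator. -/
def Corep.opUnit {s : G →* ℤˣ} {ω : FactorSystem s} {d : ℕ} (ρ : Corep s ω d) (g : G) :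
    (Module.End ℝ (Carrier d))ˣ where
  val := ρ.op g
  inv := kappa d (s g) * matOp (ρ.M g)⁻¹
  val_inv := by
    rw [Corep.op, mul_assoc, ← mul_assoc (kappa d (s g)) (kappa d (s g)), kappa_mul_self, one_mul,
      ← matOp_mul, ρ.mul_inv, matOp_one]
  inv_val := by
    rw [Corep.op, mul_assoc, ← mul_assoc (matOp _) (matOp _), ← matOp_mul, ρ.inv_mul, matOp_one,
      one_mul, kappa_mul_self]

/-- The matrix `q_r` represents the operator `∑_g [M(g)κ_{s(g)}] Q₀ [M(g)κ_{s(g)}]⁻¹`. -/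
theorem Corep.matOp_avg [Fintype G] {s : G →* ℤˣ} {ω : FactorSystem s} {d : ℕ}
    (ρ : Corep s ω d) (Q₀ : Matrix (Fin d) (Fin d) ℂ) :
    matOp (ρ.avg Q₀)
      = ∑ g, (ρ.opUnit g : Module.End ℝ (Carrier d)) * matOp Q₀ *
          ((ρ.opUnit g)⁻¹ : (Module.End ℝ (Carrier d))ˣ) := by
  have hsum : matOp (ρ.avg Q₀)
      = ∑ g, matOp (ρ.M g * kappaConj (s g) Q₀ * (ρ.M g)⁻¹) := by
    ext v i
    simp [matOp, Corep.avg, LinearMap.sum_apply]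
  rw [hsum]
  refine Finset.sum_congr rfl fun g _ => ?_
  change _ = (matOp (ρ.M g) * kappa d (s g)) * matOp Q₀ * (kappa d (s g) * matOp (ρ.M g)⁻¹)
  rw [mul_assoc (matOp (ρ.M g)), kappa_mul_matOp, matOp_mul, matOp_mul]
  simp only [mul_assoc]
  rw [← mul_assoc (kappa d (s g)) (kappa d (s g)), kappa_mul_self, one_mul]

end ProjCorep

end

/-! The real-linear map `Q₀ ↦ Q_r` sends everything to Hermitian matrices commuting with the
co-representation, and reaches all of them, since on these it is multiplication by `2|G|`. Their
eigenvalues are real, so their eigenspaces are invariant even under antilinear operators. If a `Q_r`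
has the largest possible number of distinct eigenvalues, its eigenspaces are irreducible: the
projector onto a proper nonzero invariant part of one of them lies in the range of the map, and
adding a small multiple would create a new eigenvalue.

Maximality is generic. A Hermitian `A` has at least `N` distinct eigenvalues iff the determinant of
the moments `tr (A ^ (i + j))`, `i, j < N`, is nonzero. Along a line `A + tB` this determinant is a
polynomial in `t` whose coefficient of degree `N(N-1)` is its value at `B`. Taking for `B` a maximal
`Q_r`, each line in that direction meets the bad set in finitely many points, so the bad set is
Lebesgue-null by Fubini, and null for the law of `Q₀` by absolute continuity. -/

noncomputable section

/-! ### Counting eigenvalues by Hankel determinants of moments -/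

open Polynomial in
/-- An endomorphism whose eigenspaces span is annihilated by every polynomial vanishing at its
eigenvalues. -/
theorem Module.End.aeval_eq_zero_of_iSup_eigenspace {K V : Type*} [Field K] [AddCommGroup V]
    [Module K V] {f : Module.End K V} (hf : ⨆ μ, f.eigenspace μ = ⊤) {p : K[X]}
    (hp : ∀ μ, f.HasEigenvalue μ → p.eval μ = 0) : aeval f p = 0 := by
  rw [← LinearMap.ker_eq_top, eq_top_iff, ← hf, iSup_le_iff]
  intro μ v hv
  by_cases h0 : v = 0
  · simp [h0]
  have hev : f.HasEigenvector μ v := ⟨hv, h0⟩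
  rw [LinearMap.mem_ker, aeval_apply_of_hasEigenvector hev,
    hp μ (hasEigenvalue_of_hasEigenvector hev), zero_smul]

namespace Matrix

variable {n : Type*} [Fintype n] [DecidableEq n]

open Polynomial in
theorem IsHermitian.aeval_eq_zero {A : Matrix n n ℂ} (hA : A.IsHermitian) {p : ℂ[X]}
    (hp : ∀ μ ∈ spectrum ℂ A, p.eval μ = 0) : aeval A p = 0 := by
  have hsymm := isSymmetric_toEuclideanLin_iff.2 hA
  have htop : ⨆ μ, Module.End.eigenspace (toEuclideanLin A) μ = ⊤ :=
    (Submodule.orthogonal_eq_bot_iff).1 hsymm.orthogonalComplement_iSup_eigenspaces_eq_bot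
  have h := Module.End.aeval_eq_zero_of_iSup_eigenspace htop (p := p) fun μ hμ => hp μ <| by
    rw [← spectrum_toLpLin 2]
    exact Module.End.hasEigenvalue_iff_mem_spectrum.1 hμ
  have h2 : toLpLinAlgEquiv 2 (aeval A p) = 0 := by
    rw [← aeval_algHom_apply]
    exact h
  simpa using h2

/-- The Hankel matrix of the moments `tr (A ^ k)`. -/
def traceHankel {R : Type*} [CommRing R] (N : ℕ) (A : Matrix n n R) : Matrix (Fin N) (Fin N) R :=
  of fun i j => (A ^ ((i : ℕ) + j)).trace

/-- Row `i` and column `j` are rescaled by `c ^ i` and `c ^ j`, so the determinant is homogeneous.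
-/
theorem traceHankel_smul {R : Type*} [CommRing R] (N : ℕ) (c : R) (A : Matrix n n R) :
    (traceHankel N (c • A)).det
      = (∏ i : Fin N, c ^ (i : ℕ)) * ((∏ i : Fin N, c ^ (i : ℕ)) * (traceHankel N A).det) := by
  rw [← det_mul_row, ← det_mul_column]
  congr 1
  ext i j
  simp only [traceHankel, of_apply, smul_pow, trace_smul, smul_eq_mul]
  rw [pow_add, mul_assoc]

theorem map_traceHankel {R S : Type*} [CommRing R] [CommRing S] (f : R →+* S) (N : ℕ)
    (A : Matrix n n R) : (traceHankel N A).map f = traceHankel N (A.map f) := by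
  ext i j
  simp only [traceHankel, of_apply, map_apply, ← Matrix.map_pow]
  exact AddMonoidHom.map_trace f.toAddMonoidHom _

/-- Reads a kernel vector of the Hankel matrix as a polynomial in `A` that is trace-orthogonal to
the powers `A ^ i`, `i < N`. -/
theorem traceHankel_mulVec {R : Type*} [CommRing R] (N : ℕ) (A : Matrix n n R) (v : Fin N → R)
    (i : Fin N) :
    (traceHankel N A *ᵥ v) i = (A ^ (i : ℕ) * ∑ j, v j • A ^ (j : ℕ)).trace := by
  simp only [mulVec, dotProduct, traceHankel, of_apply, Finset.mul_sum, trace_sum, mul_smul_comm,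
    trace_smul, pow_add, smul_eq_mul]
  exact Finset.sum_congr rfl fun j _ => mul_comm _ _

open Polynomial in
theorem aeval_eq_sum_fin {R : Type*} [CommRing R] {N : ℕ} {p : R[X]} (hp : p.natDegree < N)
    (A : Matrix n n R) : aeval A p = ∑ j : Fin N, p.coeff j • A ^ (j : ℕ) := by
  rw [aeval_eq_sum_range' hp, Fin.sum_univ_eq_sum_range (fun j => p.coeff j • A ^ j)]

theorem finite_spectrum_complex (A : Matrix n n ℂ) : (spectrum ℂ A).Finite := by
  rw [← spectrum_toLpLin 2]
  exact Module.End.finite_spectrum _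

open Polynomial ComplexOrder in
/-- A Hermitian matrix has at least `N` distinct eigenvalues iff its Hankel matrix of moments of
size `N` is nonsingular. -/
theorem IsHermitian.det_traceHankel_ne_zero_iff {A : Matrix n n ℂ} (hA : A.IsHermitian) (N : ℕ) :
    (traceHankel N A).det ≠ 0 ↔ N ≤ (spectrum ℂ A).ncard := by
  have hfin := finite_spectrum_complex A
  rw [← not_lt, ne_eq, not_iff_not, ← exists_mulVec_eq_zero_iff]
  constructor
  · rintro ⟨v, hv0, hv⟩
    set p : ℂ[X] := ∑ j : Fin N, monomial (j : ℕ) (v j) with hp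
    have hcoeff : ∀ j : Fin N, p.coeff j = v j := fun j => by
      simp [hp, coeff_monomial, Fin.val_inj]
    have hdeg : p.degree < N := by
      refine (degree_sum_le _ _).trans_lt ?_
      refine (Finset.sup_lt_iff (WithBot.bot_lt_coe N)).2 ?_
      exact fun j _ => (degree_monomial_le _ _).trans_lt (WithBot.coe_lt_coe.2 j.2)
    have hp0 : p ≠ 0 := by
      rintro h
      exact hv0 (funext fun j => by simp [← hcoeff, h])
    set B := ∑ j, v j • A ^ (j : ℕ) with hB
    have hpB : aeval A p = B := by
      rw [aeval_eq_sum_fin ((natDegree_lt_iff_degree_lt hp0).2 hdeg), hB]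
      simp only [hcoeff]
    have hBH : Bᴴ = ∑ i, star (v i) • A ^ (i : ℕ) := by
      simp [hB, conjTranspose_sum, conjTranspose_smul, conjTranspose_pow, hA.eq]
    -- `Bᴴ` is itself a combination of the powers `A ^ i`, `i < N`, because `A` is Hermitian;
    -- positivity of the trace form then forces `B = 0`.
    have htr : (Bᴴ * B).trace = 0 := by
      rw [hBH, Finset.sum_mul, trace_sum]
      refine Finset.sum_eq_zero fun i _ => ?_
      rw [smul_mul_assoc, trace_smul, ← traceHankel_mulVec, hv]
      simp
    have hB0 : aeval A p = 0 := hpB.trans (trace_conjTranspose_mul_self_eq_zero_iff.1 htr)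
    have hsub : spectrum ℂ A ⊆ p.roots.toFinset := fun μ hμ => by
      have := spectrum.subset_polynomial_aeval A p ⟨μ, hμ, rfl⟩
      rw [hB0] at this
      have hne : Nontrivial (Matrix n n ℂ) := by
        by_contra hne
        rw [not_nontrivial_iff_subsingleton] at hne
        simp [spectrum.of_subsingleton] at hμ
      rw [spectrum.zero_eq] at this
      simpa [hp0] using this
    calc (spectrum ℂ A).ncard ≤ p.roots.toFinset.card := by
          rw [← Set.ncard_coe_finset]
          exact Set.ncard_le_ncard hsub (Finset.finite_toSet _)
      _ ≤ p.natDegree := (Multiset.toFinset_card_le _).trans p.card_roots'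
      _ < N := (natDegree_lt_iff_degree_lt hp0).2 hdeg
  · intro hlt
    -- This annihilates `A` by diagonalizability; its degree is the number of eigenvalues, so its
    -- coefficients fit in a vector of length `N`.
    set p : ℂ[X] := ∏ μ ∈ hfin.toFinset, (X - C μ) with hp
    have hmonic : p.Monic := monic_prod_of_monic _ _ fun μ _ => monic_X_sub_C μ
    have hdeg : p.natDegree < N := by
      rw [hp, natDegree_prod_of_monic _ _ fun μ _ => monic_X_sub_C μ]
      simpa [← Set.ncard_eq_toFinset_card _ hfin] using hlt
    refine ⟨fun j => p.coeff j, fun h => ?_, ?_⟩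
    · have := congrFun h ⟨p.natDegree, hdeg⟩
      rw [Pi.zero_apply, coeff_natDegree, hmonic.leadingCoeff] at this
      exact one_ne_zero this
    · ext i
      rw [traceHankel_mulVec, ← aeval_eq_sum_fin hdeg, hA.aeval_eq_zero fun μ hμ => ?_]
      · simp
      · rw [hp, eval_prod]
        exact Finset.prod_eq_zero (hfin.mem_toFinset.2 hμ) (by simp)

open Polynomial in
/-- On a real line in the direction `B`, a nonsingular Hankel matrix of moments at `B` forces
nonsingularity at all but finitely many points. -/
theorem finite_setOf_det_traceHankel_add_smul_eq_zero {N : ℕ} (A : Matrix n n ℂ)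
    {B : Matrix n n ℂ} (hB : (traceHankel N B).det ≠ 0) :
    {t : ℂ | (traceHankel N (A + t • B)).det = 0}.Finite := by
  -- The reversed polynomial, in the variable `t⁻¹`: its value at `0` is the determinant at `B`, so
  -- no leading coefficient has to be computed.
  set p : ℂ[X] := (traceHankel N (A.map C * scalar n X + B.map C)).det with hp
  have heval : ∀ t, p.eval t = (traceHankel N (t • A + B)).det := fun t => by
    rw [← coe_evalRingHom, hp, RingHom.map_det, RingHom.mapMatrix_apply, map_traceHankel]
    congr 2
    ext i j
    simp only [scalar_apply, map_apply, add_apply, mul_diagonal, smul_apply, coe_evalRingHom,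
      eval_add, eval_mul, eval_C, eval_X, smul_eq_mul, mul_comm t]
  have hp0 : p ≠ 0 := fun h => hB (by simpa [h] using (heval 0).symm)
  refine ((p.roots.toFinset.finite_toSet.image (·⁻¹)).insert 0).subset fun t ht => ?_
  by_cases ht0 : t = 0
  · exact Or.inl ht0
  · refine Or.inr ⟨t⁻¹, ?_, inv_inv t⟩
    have hscale : A + t • B = t • (t⁻¹ • A + B) := by
      rw [smul_add, smul_smul, mul_inv_cancel₀ ht0, one_smul]
    rw [Set.mem_ofPred_eq, hscale, traceHankel_smul] at ht
    have hne : ∏ i : Fin N, t ^ (i : ℕ) ≠ 0 := Finset.prod_ne_zero_iff.2 fun i _ => pow_ne_zero _ ht0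
    simpa [hp0, heval, hne] using ht

theorem continuous_det_traceHankel (N : ℕ) :
    Continuous fun A : Matrix n n ℂ => (traceHankel N A).det := by
  refine Continuous.matrix_det (continuous_matrix fun i j => ?_)
  exact (continuous_id.pow _).matrix_trace

end Matrix

/-! ### Invariant subspaces, commuting matrices and the averaging map -/

namespace ProjCorep

variable {G : Type*} [Group G] {s : G →* ℤˣ} {ω : FactorSystem s} {d : ℕ}

theorem kappaConj_add (ε : ℤˣ) (A B : Matrix (Fin d) (Fin d) ℂ) :
    kappaConj ε (A + B) = kappaConj ε A + kappaConj ε B := by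
  unfold kappaConj
  split_ifs
  · rfl
  · ext; simp

theorem kappaConj_real_smul (ε : ℤˣ) (c : ℝ) (A : Matrix (Fin d) (Fin d) ℂ) :
    kappaConj ε (c • A) = c • kappaConj ε A := by
  unfold kappaConj
  split_ifs
  · rfl
  · ext; simp

theorem kappaConj_conjTranspose (ε : ℤˣ) (A : Matrix (Fin d) (Fin d) ℂ) :
    kappaConj ε A.conjTranspose = (kappaConj ε A).conjTranspose := by
  unfold kappaConj
  split_ifs
  · rfl
  · ext; simp

theorem continuous_kappaConj (ε : ℤˣ) :
    Continuous (kappaConj ε : Matrix (Fin d) (Fin d) ℂ → Matrix (Fin d) (Fin d) ℂ) := by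
  unfold kappaConj
  split_ifs
  · exact continuous_id
  · exact continuous_id.matrix_map Complex.continuous_conj

theorem matOp_injective : Function.Injective (matOp : Matrix (Fin d) (Fin d) ℂ → _) := by
  intro A B h
  refine Matrix.toEuclideanLin.injective (LinearMap.ext fun v => ?_)
  exact LinearMap.congr_fun h v

theorem matOp_smul (A : Matrix (Fin d) (Fin d) ℂ) (c : ℂ) (v : Carrier d) :
    matOp A (c • v) = c • matOp A v :=
  (Matrix.toEuclideanLin A).map_smul c v

theorem inner_kappa (ε : ℤˣ) (v w : Carrier d) :
    inner ℂ (kappa d ε v) (kappa d ε w)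
      = if ε = 1 then inner ℂ v w else conj (inner ℂ v w) := by
  by_cases h : ε = 1 <;> simp [kappa, h, PiLp.inner_apply]

theorem inner_matOp_of_mem_unitaryGroup {A : Matrix (Fin d) (Fin d) ℂ}
    (hA : A ∈ Matrix.unitaryGroup (Fin d) ℂ) (v w : Carrier d) :
    inner ℂ (matOp A v) (matOp A w) = inner ℂ v w := by
  change inner ℂ (Matrix.toEuclideanLin A v) (Matrix.toEuclideanLin A w) = _
  rw [← LinearMap.adjoint_inner_right, ← Matrix.toEuclideanLin_conjTranspose_eq_adjoint,
    ← LinearMap.comp_apply]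
  have := Matrix.toLpLin_mul_same 2 A.conjTranspose A
  rw [← this, ← Matrix.star_eq_conjTranspose, Matrix.mem_unitaryGroup_iff'.1 hA]
  simp

namespace Corep

variable (ρ : Corep s ω d)

theorem inner_op (g : G) (v w : Carrier d) :
    inner ℂ (ρ.op g v) (ρ.op g w) = if s g = 1 then inner ℂ v w else conj (inner ℂ v w) := by
  rw [← inner_kappa, ← inner_matOp_of_mem_unitaryGroup (ρ.unitary g) (kappa d (s g) v)]
  rfl

theorem op_injective (g : G) : Function.Injective (ρ.op g) :=
  (Module.End.isUnit_iff _).1 (ρ.opUnit g).isUnit |>.1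

theorem op_smul (g : G) (c : ℂ) (v : Carrier d) :
    ρ.op g (c • v) = (if s g = 1 then c else conj c) • ρ.op g v := by
  have h : kappa d (s g) (c • v) = (if s g = 1 then c else conj c) • kappa d (s g) v := by
    ext i
    by_cases h : s g = 1 <;> simp [kappa, h]
  change matOp (ρ.M g) (kappa d (s g) (c • v)) = _
  rw [h, matOp_smul]
  rfl

-- An injective real-linear map of the finite-dimensional `W` into itself is onto. This avoids
-- inverting `g`, which would bring in phases.
variable {ρ} in
theorem Invariant.exists_op_eq {W : Submodule ℂ (Carrier d)} (hW : ρ.Invariant W) (g : G)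
    {w : Carrier d} (hw : w ∈ W) : ∃ v ∈ W, ρ.op g v = w := by
  let f : W.restrictScalars ℝ →ₗ[ℝ] W.restrictScalars ℝ := (ρ.op g).restrict (hW g)
  have hf : Function.Injective f := fun x y h =>
    Subtype.ext (ρ.op_injective g (congrArg Subtype.val h))
  obtain ⟨v, hv⟩ := LinearMap.injective_iff_surjective.1 hf ⟨w, hw⟩
  exact ⟨v, v.2, congrArg Subtype.val hv⟩

variable {ρ} in
theorem Invariant.orthogonal {W : Submodule ℂ (Carrier d)} (hW : ρ.Invariant W) :
    ρ.Invariant Wᗮ := by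
  intro g v hv w hw
  obtain ⟨u, hu, rfl⟩ := hW.exists_op_eq g hw
  rw [ρ.inner_op, hv u hu]
  simp

variable {ρ} in
theorem Invariant.starProjection_op {W : Submodule ℂ (Carrier d)} (hW : ρ.Invariant W) (g : G)
    (v : Carrier d) : W.starProjection (ρ.op g v) = ρ.op g (W.starProjection v) := by
  refine Submodule.eq_starProjection_of_mem_orthogonal (hW g _ (Submodule.coe_mem _)) ?_
  rw [← map_sub]
  exact hW.orthogonal g _ (Submodule.sub_starProjection_mem_orthogonal v)

/-- The matrix `A` commutes with every `M(g)κ_{s(g)}`. -/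
def Commutes (A : Matrix (Fin d) (Fin d) ℂ) : Prop :=
  ∀ g, ρ.M g * kappaConj (s g) A = A * ρ.M g

theorem commutes_iff {A : Matrix (Fin d) (Fin d) ℂ} :
    ρ.Commutes A ↔ ∀ g, matOp A * ρ.op g = ρ.op g * matOp A := by
  refine forall_congr' fun g => ?_
  rw [op, mul_assoc (matOp _) (kappa _ _), kappa_mul_matOp, ← mul_assoc, ← mul_assoc, ← matOp_mul,
    ← matOp_mul]
  constructor
  · intro h
    rw [h]
  · intro h
    have h2 := congrArg (· * kappa d (s g)) h
    simp only [mul_assoc, kappa_mul_self, mul_one] at h2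
    exact (matOp_injective h2).symm

variable {ρ}

theorem Commutes.op {A : Matrix (Fin d) (Fin d) ℂ} (hA : ρ.Commutes A) (g : G) (v : Carrier d) :
    Matrix.toEuclideanLin A (ρ.op g v) = ρ.op g (Matrix.toEuclideanLin A v) :=
  LinearMap.congr_fun (ρ.commutes_iff.1 hA g) v

theorem Commutes.add {A B : Matrix (Fin d) (Fin d) ℂ} (hA : ρ.Commutes A) (hB : ρ.Commutes B) :
    ρ.Commutes (A + B) := fun g => by
  rw [kappaConj_add, mul_add, add_mul, hA g, hB g]

theorem Commutes.conjTranspose {A : Matrix (Fin d) (Fin d) ℂ} (hA : ρ.Commutes A) :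
    ρ.Commutes A.conjTranspose := fun g => by
  have h := congrArg Matrix.conjTranspose (hA g)
  rw [Matrix.conjTranspose_mul, Matrix.conjTranspose_mul, ← kappaConj_conjTranspose] at h
  have h1 : ρ.M g * (ρ.M g).conjTranspose = 1 := Matrix.mem_unitaryGroup_iff.1 (ρ.unitary g)
  have h2 : (ρ.M g).conjTranspose * ρ.M g = 1 := Matrix.mem_unitaryGroup_iff'.1 (ρ.unitary g)
  calc ρ.M g * kappaConj (s g) A.conjTranspose
      = ρ.M g * (kappaConj (s g) A.conjTranspose * (ρ.M g).conjTranspose) * ρ.M g := by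
        rw [mul_assoc, mul_assoc, h2, mul_one]
    _ = A.conjTranspose * ρ.M g := by rw [h, ← mul_assoc, h1, one_mul]

theorem Invariant.commutes_starProjection {W : Submodule ℂ (Carrier d)} (hW : ρ.Invariant W) :
    ρ.Commutes (Matrix.toEuclideanLin.symm (W.starProjection : Carrier d →ₗ[ℂ] Carrier d)) := by
  rw [commutes_iff]
  intro g
  ext1 v
  simp only [matOp, Module.End.mul_apply, LinearMap.restrictScalars_apply,
    LinearEquiv.apply_symm_apply]
  exact hW.starProjection_op g v

variable (ρ)

theorem op_mul_op (g h : G) (v : Carrier d) :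
    ρ.op g (ρ.op h v) = (ω.toFun g h : ℂ) • ρ.op (g * h) v :=
  ρ.mul g h v

/-- Left translation by `h` permutes the summands: `ρ.op h` after `ρ.op g` is `ρ.op (h * g)` up to a
phase, and the phase passes through complex-linear matrices. -/
theorem commutes_avg [Fintype G] (Q : Matrix (Fin d) (Fin d) ℂ) : ρ.Commutes (ρ.avg Q) := by
  rw [commutes_iff]
  intro h
  suffices hsuff : ∀ g, matOp (ρ.M (h * g) * kappaConj (s (h * g)) Q * (ρ.M (h * g))⁻¹) * ρ.op h
      = ρ.op h * matOp (ρ.M g * kappaConj (s g) Q * (ρ.M g)⁻¹) by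
    have hsum : ∀ F : G → Matrix (Fin d) (Fin d) ℂ, matOp (∑ g, F g) = ∑ g, matOp (F g) := by
      intro F
      ext1 v
      simp [matOp, LinearMap.sum_apply]
    rw [avg, hsum, Finset.mul_sum, ← Finset.sum_congr rfl fun g _ => hsuff g, Finset.sum_mul]
    exact (Equiv.sum_comp (Equiv.mulLeft h) fun g =>
      matOp (ρ.M g * kappaConj (s g) Q * (ρ.M g)⁻¹) * ρ.op h).symm
  have key : ∀ g, matOp (ρ.M g * kappaConj (s g) Q * (ρ.M g)⁻¹) * ρ.op g = ρ.op g * matOp Q := by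
    intro g
    rw [op, mul_assoc (matOp _) (kappa _ _), kappa_mul_matOp, ← mul_assoc, ← mul_assoc,
      ← matOp_mul, ← matOp_mul, mul_assoc _ (ρ.M g)⁻¹, ρ.inv_mul, mul_one]
  intro g
  ext1 v
  obtain ⟨u, rfl⟩ := ((Module.End.isUnit_iff _).1 (ρ.opUnit g).isUnit).2 v
  change matOp _ (ρ.op h (ρ.op g u)) = ρ.op h (matOp _ (ρ.op g u))
  have h1 := LinearMap.congr_fun (key g) u
  have h2 := LinearMap.congr_fun (key (h * g)) u
  simp only [Module.End.mul_apply] at h1 h2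
  rw [h1, op_mul_op, op_mul_op, matOp_smul, h2]

section

variable [Fintype G]

theorem commutes_hermAvg (Q : Matrix (Fin d) (Fin d) ℂ) : ρ.Commutes (ρ.hermAvg Q) :=
  (ρ.commutes_avg Q).add (ρ.commutes_avg Q).conjTranspose

theorem isHermitian_hermAvg (Q : Matrix (Fin d) (Fin d) ℂ) : (ρ.hermAvg Q).IsHermitian :=
  Matrix.isHermitian_add_transpose_self _

theorem isSymmetric_hermOp (Q : Matrix (Fin d) (Fin d) ℂ) : (ρ.hermOp Q).IsSymmetric :=
  Matrix.isSymmetric_toEuclideanLin_iff.2 (ρ.isHermitian_hermAvg Q)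

theorem avg_add (Q R : Matrix (Fin d) (Fin d) ℂ) : ρ.avg (Q + R) = ρ.avg Q + ρ.avg R := by
  simp [avg, kappaConj_add, mul_add, add_mul, Finset.sum_add_distrib]

theorem avg_real_smul (c : ℝ) (Q : Matrix (Fin d) (Fin d) ℂ) : ρ.avg (c • Q) = c • ρ.avg Q := by
  simp [avg, kappaConj_real_smul, Finset.smul_sum]

theorem hermAvg_add (Q R : Matrix (Fin d) (Fin d) ℂ) :
    ρ.hermAvg (Q + R) = ρ.hermAvg Q + ρ.hermAvg R := by
  rw [hermAvg, avg_add, Matrix.conjTranspose_add, hermAvg, hermAvg]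
  abel

theorem hermAvg_real_smul (c : ℝ) (Q : Matrix (Fin d) (Fin d) ℂ) :
    ρ.hermAvg (c • Q) = c • ρ.hermAvg Q := by
  rw [hermAvg, avg_real_smul, Matrix.conjTranspose_smul, hermAvg, smul_add, star_trivial]

theorem continuous_hermAvg : Continuous ρ.hermAvg := by
  have h : Continuous ρ.avg := continuous_finsetSum _ fun g _ =>
    (continuous_const.matrix_mul (continuous_kappaConj (s g))).matrix_mul continuous_const
  exact h.add h.matrix_conjTranspose

variable {ρ}

theorem Commutes.hermAvg_eq {A : Matrix (Fin d) (Fin d) ℂ} (hA : ρ.Commutes A)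
    (hH : A.IsHermitian) : ρ.hermAvg A = (2 * Fintype.card G : ℝ) • A := by
  have h : ρ.avg A = (Fintype.card G : ℝ) • A := by
    simp only [avg, hA _, mul_assoc, ρ.mul_inv, mul_one, Finset.sum_const, Finset.card_univ]
    exact (Nat.cast_smul_eq_nsmul ℝ _ _).symm
  rw [hermAvg, h, Matrix.conjTranspose_smul, hH.eq, star_trivial, ← add_smul, two_mul]

theorem Commutes.exists_hermAvg_eq {A : Matrix (Fin d) (Fin d) ℂ} (hA : ρ.Commutes A)
    (hH : A.IsHermitian) : ∃ Q, ρ.hermAvg Q = A := by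
  refine ⟨(2 * Fintype.card G : ℝ)⁻¹ • A, ?_⟩
  rw [hermAvg_real_smul, hA.hermAvg_eq hH, smul_smul, inv_mul_cancel₀ (by simp), one_smul]

variable (ρ)

/-- An antilinear operator conjugates the eigenvalue, which does no harm because it is real. -/
theorem invariant_eigenspace (Q : Matrix (Fin d) (Fin d) ℂ) {μ : ℂ}
    (hμ : (ρ.hermOp Q).HasEigenvalue μ) : ρ.Invariant ((ρ.hermOp Q).eigenspace μ) := by
  intro g v hv
  rw [Module.End.mem_eigenspace_iff] at hv ⊢
  rw [hermOp, (ρ.commutes_hermAvg Q).op g v]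
  change ρ.op g (ρ.hermOp Q v) = _
  rw [hv, op_smul, (ρ.isSymmetric_hermOp Q).conj_eigenvalue_eq_self hμ, ite_self]

end
end Corep
end ProjCorep

/-! ### Maximal spectra: irreducibility and genericity -/

namespace ProjCorep.Corep

variable {G : Type*} [Group G] [Fintype G] {s : G →* ℤˣ} {ω : FactorSystem s} {d : ℕ}
  (ρ : Corep s ω d)

theorem hasEigenvalue_hermOp_iff {Q : Matrix (Fin d) (Fin d) ℂ} {μ : ℂ} :
    (ρ.hermOp Q).HasEigenvalue μ ↔ μ ∈ spectrum ℂ (ρ.hermAvg Q) := by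
  rw [Module.End.hasEigenvalue_iff_mem_spectrum, hermOp, Matrix.spectrum_toLpLin 2]

/-- If `Q_r` has the largest possible number of distinct eigenvalues, its eigenspaces are
irreducible: otherwise a multiple of the projector onto an invariant subspace of an eigenspace could
be added to split that eigenspace. -/
theorem isIrreducibleComponent_eigenspace {Q : Matrix (Fin d) (Fin d) ℂ}
    (hmax : ∀ R, (spectrum ℂ (ρ.hermAvg R)).ncard ≤ (spectrum ℂ (ρ.hermAvg Q)).ncard)
    {μ : ℂ} (hμ : (ρ.hermOp Q).HasEigenvalue μ) :
    ρ.IsIrreducibleComponent ((ρ.hermOp Q).eigenspace μ) := by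
  refine ⟨hμ, ρ.invariant_eigenspace Q hμ, fun W hW hinv => ?_⟩
  by_contra! hne
  obtain ⟨hbot, htop⟩ := hne
  have hfin := Matrix.finite_spectrum_complex (ρ.hermAvg Q)
  -- The spectrum is finite and there are infinitely many real shifts, so some shift of `μ` is a new
  -- value.
  obtain ⟨ε, hε⟩ : ∃ ε : ℝ, μ + ε ∉ spectrum ℂ (ρ.hermAvg Q) := by
    have hinj : Function.Injective fun ε : ℝ => μ + ε := fun a b h =>
      Complex.ofReal_injective (add_left_cancel h)
    exact (hfin.preimage hinj.injOn).exists_notMem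
  set p := Matrix.toEuclideanLin.symm (W.starProjection : Carrier d →ₗ[ℂ] Carrier d) with hp
  have hpH : p.IsHermitian := by
    rw [← Matrix.isSymmetric_toEuclideanLin_iff, hp, LinearEquiv.apply_symm_apply]
    exact W.starProjection_isSymmetric
  obtain ⟨R, hR⟩ := hinv.commutes_starProjection.exists_hermAvg_eq hpH
  have hsum : ρ.hermAvg (Q + ε • R) = ρ.hermAvg Q + ε • p := by
    rw [hermAvg_add, hermAvg_real_smul, hR]
  have happ : ∀ v, ρ.hermOp (Q + ε • R) v = ρ.hermOp Q v + (ε : ℂ) • W.starProjection v := by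
    intro v
    have hc : ε • p = (ε : ℂ) • p := by ext; simp
    rw [hermOp, hsum, hc, map_add, map_smul, hp, LinearEquiv.apply_symm_apply]
    rfl
  have hmem : ∀ {ν : ℂ} {v : Carrier d}, v ≠ 0 → ρ.hermOp (Q + ε • R) v = ν • v →
      ν ∈ spectrum ℂ (ρ.hermAvg (Q + ε • R)) := fun hv h =>
    ρ.hasEigenvalue_hermOp_iff.1 <| Module.End.hasEigenvalue_of_hasEigenvector
      ⟨Module.End.mem_eigenspace_iff.2 h, hv⟩
  have hsub : insert (μ + ε) (spectrum ℂ (ρ.hermAvg Q))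
      ⊆ spectrum ℂ (ρ.hermAvg (Q + ε • R)) := by
    rintro ν (rfl | hν)
    · obtain ⟨v, hv, hv0⟩ := W.ne_bot_iff.1 hbot
      refine hmem hv0 ?_
      rw [happ, Module.End.mem_eigenspace_iff.1 (hW hv), W.starProjection_eq_self_iff.2 hv,
        add_smul]
    -- Every old eigenvalue survives through an eigenvector orthogonal to `W`, where the
    -- perturbation vanishes. For `μ` it exists because `W` is a proper subspace of the eigenspace.
    · obtain ⟨v, hv, hv0, hvW⟩ :
          ∃ v, v ∈ (ρ.hermOp Q).eigenspace ν ∧ v ≠ 0 ∧ v ∈ Wᗮ := by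
        by_cases hνμ : ν = μ
        · obtain ⟨u, hu, huW⟩ := SetLike.exists_of_lt (lt_of_le_of_ne hW htop)
          refine ⟨u - W.starProjection u, ?_, ?_, W.sub_starProjection_mem_orthogonal u⟩
          · rw [hνμ]
            exact sub_mem hu (hW (Submodule.coe_mem _))
          · exact fun h => huW (W.starProjection_eq_self_iff.1 (sub_eq_zero.1 h).symm)
        · obtain ⟨v, hv⟩ := (ρ.hasEigenvalue_hermOp_iff.2 hν).exists_hasEigenvector
          refine ⟨v, hv.1, hv.2, fun w hw => ?_⟩
          exact (ρ.isSymmetric_hermOp Q).orthogonalFamily_eigenspaces (Ne.symm hνμ)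
            ⟨w, hW hw⟩ ⟨v, hv.1⟩
      refine hmem hv0 ?_
      rw [happ, Module.End.mem_eigenspace_iff.1 hv,
        (W.starProjection_apply_eq_zero_iff).2 hvW, smul_zero, add_zero]
  have h1 := Set.ncard_le_ncard hsub (Matrix.finite_spectrum_complex _)
  rw [Set.ncard_insert_of_notMem hε hfin] at h1
  exact absurd (hmax (Q + ε • R)) (by omega)

theorem eigenspacesReduce_of_forall_ncard_le {Q : Matrix (Fin d) (Fin d) ℂ}
    (hmax : ∀ R, (spectrum ℂ (ρ.hermAvg R)).ncard ≤ (spectrum ℂ (ρ.hermAvg Q)).ncard) :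
    ρ.EigenspacesReduce Q where
  irreducible μ := ρ.isIrreducibleComponent_eigenspace hmax μ.2
  isInternal := (ρ.isSymmetric_hermOp Q).direct_sum_isInternal
  orthogonal μ ν hμν := by
    refine Submodule.IsOrtho.starProjection_comp_starProjection ?_
    exact (ρ.isSymmetric_hermOp Q).orthogonalFamily_eigenspaces'.isOrtho hμν
  sum_eq_id := by
    ext1 v
    rw [_root_.sum_apply]
    refine (ρ.isSymmetric_hermOp Q).orthogonalFamily_eigenspaces'.sum_projection_of_mem_iSup v ?_
    rw [(ρ.isSymmetric_hermOp Q).direct_sum_isInternal.submodule_iSup_eq_top]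
    trivial
  commute μ g v := (ρ.invariant_eigenspace Q μ.2).starProjection_op g v

theorem ncard_spectrum_le (A : Matrix (Fin d) (Fin d) ℂ) : (spectrum ℂ A).ncard ≤ d := by
  by_contra! h
  have hfin := Matrix.finite_spectrum_complex A
  have hsub : spectrum ℂ A ⊆ A.charpoly.roots.toFinset := fun μ hμ => by
    simpa [A.charpoly_monic.ne_zero] using Matrix.mem_spectrum_iff_isRoot_charpoly.1 hμ
  have h1 := Set.ncard_le_ncard hsub (Finset.finite_toSet _)
  rw [Set.ncard_coe_finset] at h1
  have h2 := (Multiset.toFinset_card_le A.charpoly.roots).trans A.charpoly.card_roots'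
  rw [A.charpoly_natDegree_eq_dim, Fintype.card_fin] at h2
  omega

/-- The number of distinct eigenvalues of `Q_r` is maximal for Lebesgue-almost every `Q₀`. -/
theorem ae_forall_ncard_spectrum_hermAvg_le :
    ∀ᵐ Q : Fin d → Fin d → ℂ, ∀ R,
      (spectrum ℂ (ρ.hermAvg R)).ncard ≤ (spectrum ℂ (ρ.hermAvg (Matrix.of Q))).ncard := by
  obtain ⟨B, hB⟩ : ∃ B, ∀ R,
      (spectrum ℂ (ρ.hermAvg R)).ncard ≤ (spectrum ℂ (ρ.hermAvg B)).ncard := by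
    have hbdd : BddAbove (Set.range fun R => (spectrum ℂ (ρ.hermAvg R)).ncard) :=
      ⟨d, Set.forall_mem_range.2 fun R => ncard_spectrum_le _⟩
    obtain ⟨B, hB⟩ := Nat.sSup_mem (Set.range_nonempty _) hbdd
    exact ⟨B, fun R => (le_csSup hbdd ⟨R, rfl⟩).trans_eq hB.symm⟩
  set N := (spectrum ℂ (ρ.hermAvg B)).ncard
  set S : Set (Fin d → Fin d → ℂ) :=
    {Q | (Matrix.traceHankel N (ρ.hermAvg (Matrix.of Q))).det ≠ 0} with hS
  have hSopen : IsOpen S :=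
    isOpen_ne.preimage ((Matrix.continuous_det_traceHankel N).comp ρ.continuous_hermAvg)
  have hBdet := ((ρ.isHermitian_hermAvg B).det_traceHankel_ne_zero_iff N).2 le_rfl
  have hmem : ∀ᵐ Q : Fin d → Fin d → ℂ, Q ∈ S := by
    have hrow : (volume : Measure (Fin d → ℂ)).IsAddHaarMeasure :=
      Measure.pi.isAddHaarMeasure fun _ => volume
    have hmat : (volume : Measure (Fin d → Fin d → ℂ)).IsAddHaarMeasure :=
      Measure.pi.isAddHaarMeasure fun _ => volume
    -- Fubini along the lines `Q + tB`: it suffices that each of them lies in `S` for almost every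
    -- real `t`.
    refine ae_mem_of_ae_add_linearMap_mem
      (LinearMap.toSpanSingleton ℝ (Fin d → Fin d → ℂ) (Matrix.of.symm B)) volume volume
      hSopen.measurableSet fun Q => ?_
    have hfin := (Matrix.finite_setOf_det_traceHankel_add_smul_eq_zero
      (ρ.hermAvg (Matrix.of Q)) hBdet).preimage (Complex.ofReal_injective.injOn)
    filter_upwards [hfin.countable.ae_notMem volume] with t ht
    have hc : t • ρ.hermAvg B = (t : ℂ) • ρ.hermAvg B := by ext; simp
    rw [Set.mem_preimage, Set.mem_ofPred_eq, ← hc, ← hermAvg_real_smul, ← hermAvg_add] at ht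
    exact ht
  filter_upwards [hmem] with Q hQ R
  exact (hB R).trans (((ρ.isHermitian_hermAvg _).det_traceHankel_ne_zero_iff N).1 hQ)

end ProjCorep.Corep

end

theorem mainTheorem3 {G : Type*} [Group G] [Fintype G] (s : G →* ℤˣ)
    (ω : ProjCorep.FactorSystem s) (d : ℕ) (ρ : ProjCorep.Corep s ω d)
    {Ω : Type*} [MeasurableSpace Ω] (P : Measure Ω) [IsProbabilityMeasure P]
    (Q₀ : Ω → Fin d → Fin d → ℂ) (hQ₀ : AEMeasurable Q₀ P)
    (hlaw : (P.map Q₀).AbsolutelyContinuous volume) :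
    ∀ᵐ x ∂P, ρ.EigenspacesReduce (Matrix.of (Q₀ x)) := by
  filter_upwards [ae_of_ae_map hQ₀ (hlaw.ae_le ρ.ae_forall_ncard_spectrum_hermAvg_le)] with x hx
  exact ρ.eigenspacesReduce_of_forall_ncard_le hx
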